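/- Let $B$ be the $\mathbb N$-infinite Pascal–Bratteli diagram: for $n\ge 1$ its level $V_n$ is the set of vectors $\overline s=(s_i)_{i\in\mathbb N}$ of non-negative integers with $\sum_i s_i=n$ (so only finitely many $s_i$ are non-zero), and for $\overline s\in V_n$, $\overline t\in V_{n+1}$ there is exactly one edge from $\overline s$ to $\overline t$ if $\overline t=\overline s+\overline e^{(i)}$ for some $i\in\mathbb N$ (where $\overline e^{(i)}$ is the $i$-th standard basis vector), and no edge otherwise. Let $X_B$ be the space of infinite paths $x$ starting in $V_1$, passing through vertices $\overline s^{(1)}(x)\in V_1,\ \overline s^{(2)}(x)\in V_2,\dots$, with the topology generated by the cylinder sets $[\overline e]$ (all infinite paths that begin with the finite path $\overline e$ starting in $V_1$), and let measures on $X_B$ be Borel measures (atoms are allowed). A measure $\mu$ is tail invariant if $\mu([\overline e])=\mu([\overline e'])$ whenever the finite paths $\overline e,\overline e'$ starting in $V_1$ end at the same vertex; a tail invariant probability measure is ergodic if every Borel set that is a union of classes of the tail equivalence relation (two paths are equivalent if all but finitely many of their edges coincide) has measure $0$ or $1$. For every probability vector $\overline d=(d_i)_{i\in\mathbb N}$ ($d_i\ge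 0$, $\sum_i d_i=1$) there is a unique Borel measure $\mu_{\overline d}$ on $X_B$ such that $\mu_{\overline d}([\overline e])=\prod_i d_i^{s_i}$ for every finite path $\overline e$ starting in $V_1$ and ending at a vertex $\overline s$ (with $0^0=1$), and $\mu_{\overline d}$ is a tail invariant probability measure. Moreover: 1. The set of all ergodic tail invariant probability measures on $X_B$ is exactly $\{\mu_{\overline d}:\overline d \text{ a probability vector on } \mathbb N\}$. 2. For every probability vector $\overline d$, for $\mu_{\overline d}$-almost every $x\in X_B$ one has $\lim_{n\to\infty} s_i^{(n)}(x)/n=d_i$ for all $i\in\mathbb N$. 3. If $\overline c\ne\overline d$ are probability vectors, then $\mu_{\overline c}$ and $\mu_{\overline d}$ are mutually singular. -/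

import Mathlib

open MeasureTheory Filter Topology

/-- A generalized Bratteli diagram: a graded graph with levels `V 0, V 1, …`, where `E n` is the
set of edges between `V n` and `V (n + 1)`, with source map `s` and range map `r`. -/
structure GenBratteliDiagram where
  V : ℕ → Type
  E : ℕ → Type
  s : ∀ {n : ℕ}, E n → V n
  r : ∀ {n : ℕ}, E n → V (n + 1)
  countable_V : ∀ n, Countable (V n)
  infinite_V : ∀ n, Infinite (V n)
  countable_E : ∀ n, Countable (E n)
  exists_source : ∀ (n : ℕ) (v : V n), ∃ e : E n, s e = v
  exists_range : ∀ (n : ℕ) (v : V (n + 1)), ∃ e : E n, r e = v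
  finite_range_fiber : ∀ (n : ℕ) (v : V (n + 1)), {e : E n | r e = v}.Finite

namespace GenBratteliDiagram

variable (B : GenBratteliDiagram)

/-- The path space: infinite paths `(e_0, e_1, …)` starting at the initial level, `e_n ∈ E_n`. -/
def PathSpace : Type :=
  {x : ∀ n, B.E n // ∀ n, B.s (x (n + 1)) = B.r (x n)}

/-- Finite paths `(e_0, …, e_n)` starting at the initial level. -/
structure FinPath (n : ℕ) where
  edge : ∀ i, i ≤ n → B.E i
  comp : ∀ (i : ℕ) (h : i + 1 ≤ n),
    B.s (edge (i + 1) h) = B.r (edge i (Nat.le_of_succ_le h))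

variable {B}

/-- The range of a finite path: the range of its last edge. -/
def FinPath.range {n : ℕ} (e : B.FinPath n) : B.V (n + 1) := B.r (e.edge n le_rfl)

/-- The cylinder set of a finite path: all infinite paths that begin with it. -/
def FinPath.cylinder {n : ℕ} (e : B.FinPath n) : Set B.PathSpace :=
  {x | ∀ (i : ℕ) (h : i ≤ n), x.1 i = e.edge i h}

/-- The vertex of level `n` through which an infinite path passes. -/
def PathSpace.vertex (x : B.PathSpace) (n : ℕ) : B.V n := B.s (x.1 n)

/-- The topology on the path space generated by the cylinder sets. -/
instance : TopologicalSpace B.PathSpace :=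
  TopologicalSpace.generateFrom {A | ∃ (n : ℕ) (e : B.FinPath n), A = e.cylinder}

/-- The Borel σ-algebra of the path space. -/
instance : MeasurableSpace B.PathSpace := borel _

/-- Tail equivalence: two paths agree from some index on. -/
def TailEquiv (x y : B.PathSpace) : Prop := ∃ n, ∀ i, n ≤ i → x.1 i = y.1 i

/-- A measure is tail invariant if cylinder sets of finite paths with the same range
have the same measure. -/
def TailInvariant (μ : Measure B.PathSpace) : Prop :=
  ∀ (n : ℕ) (e e' : B.FinPath n), e.range = e'.range → μ e.cylinder = μ e'.cylinder

/-- A measure is ergodic (for the tail equivalence relation) if each Borel set that is a union of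
tail equivalence classes is null or conull. -/
def TailErgodic (μ : Measure B.PathSpace) : Prop :=
  ∀ A : Set B.PathSpace, MeasurableSet A →
    (∀ x y : B.PathSpace, TailEquiv x y → x ∈ A → y ∈ A) → μ A = 0 ∨ μ Aᶜ = 0

end GenBratteliDiagram

/-- The vertices `s = (s_i)` with `∑ s_i = n`. -/
abbrev PascalVertex (n : ℕ) : Type := {s : ℕ →₀ ℕ // (s.sum fun _ k => k) = n}

theorem PascalVertex.sum_add_single (s : ℕ →₀ ℕ) (i : ℕ) :
    ((s + Finsupp.single i 1).sum fun _ k => k) = (s.sum fun _ k => k) + 1 := by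
  rw [Finsupp.sum_add_index' (fun _ => rfl) (fun _ _ _ => rfl), Finsupp.sum_single_index rfl]

/-- The ℕ-infinite Pascal–Bratteli diagram. Its levels are `V_1, V_2, …`, where
`V_n` is the set of all `s` with `∑ s_i = n`; thus the level with index `n` in the structure is
`V_{n+1}`. There is exactly one edge from `s` to `t` if `t = s + e^{(i)}` for some `i`, and none
otherwise. -/
def pascalDiagram : GenBratteliDiagram where
  V n := PascalVertex (n + 1)
  E n := {p : PascalVertex (n + 1) × PascalVertex (n + 1 + 1) //
    ∃ i : ℕ, p.2.1 = p.1.1 + Finsupp.single i 1}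
  s e := e.1.1
  r e := e.1.2
  countable_V _ := inferInstance
  infinite_V n := by
    refine Infinite.of_injective
      (fun i : ℕ => (⟨Finsupp.single i (n + 1), Finsupp.sum_single_index rfl⟩ : PascalVertex (n + 1))) ?_
    intro i j h
    have h' := congrArg Subtype.val h
    exact Finsupp.single_left_injective (Nat.succ_ne_zero n) h'
  countable_E _ := inferInstance
  exists_source n v := by
    refine ⟨⟨(v, ⟨v.1 + Finsupp.single 0 1, ?_⟩), 0, rfl⟩, rfl⟩
    rw [PascalVertex.sum_add_single, v.2]
  exists_range n v := by
    have hne : v.1 ≠ 0 := by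
      intro h
      have := v.2
      rw [h] at this
      simp at this
    obtain ⟨i, hi⟩ := Finsupp.ne_iff.mp hne
    have hle : Finsupp.single i 1 ≤ v.1 := by
      rw [Finsupp.single_le_iff]
      exact Nat.one_le_iff_ne_zero.mpr hi
    have heq : v.1 = (v.1 - Finsupp.single i 1) + Finsupp.single i 1 :=
      (tsub_add_cancel_of_le hle).symm
    refine ⟨⟨(⟨v.1 - Finsupp.single i 1, ?_⟩, v), i, heq⟩, rfl⟩
    have h := v.2
    rw [heq, PascalVertex.sum_add_single] at h
    exact Nat.succ_injective h
  finite_range_fiber n v := by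
    refine Set.Finite.of_finite_image (f := fun e => e.1.1.1) ?_ ?_
    · refine (Set.finite_Iic v.1).subset ?_
      rintro _ ⟨e, he, rfl⟩
      obtain ⟨i, hi⟩ := e.2
      have he' : e.1.2 = v := he
      rw [he'] at hi
      simp only [Set.mem_Iic]
      rw [hi]
      exact le_self_add
    · intro e he e' he' h
      have h1 : e.1.2 = v := he
      have h2 : e'.1.2 = v := he'
      exact Subtype.ext (Prod.ext (Subtype.ext h) (h1.trans h2.symm))

/-- Probability vectors `d = (d_i)` on ℕ. -/
def ProbVector : Type := {d : ℕ → ℝ // (∀ i, 0 ≤ d i) ∧ HasSum d 1}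

/-- The number `∏ d_i ^ s_i` (a finite product over the support of `s`). -/
noncomputable def pascalWeight (d : ProbVector) (s : ℕ →₀ ℕ) : ℝ :=
  s.prod fun i k => d.1 i ^ k

/-!
A path of the Pascal diagram is the same thing as a sequence of letters in `ℕ`: its vertices count
the letters read so far. Under this identification (`pathEquiv`) two paths are tail equivalent if
and only if the sequences differ by a permutation of finitely many places, tail invariant measures
become exchangeable measures, and the measures with the prescribed cylinder values become the laws
of sequences of independent letters with distribution `d`. The theorem is thus the combination of
the Hewitt–Savage zero-one law and de Finetti's theorem for a countable alphabet.

*Product measures are ergodic.* Let `A` be an invariant set and `ρ` the restriction of the product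
measure to `A`; it is exchangeable. The `ρ`-mass of the sequences with a given prefix followed by
the letter `a` does not change if `a` is required at a later place instead; averaging over these
places, the law of large numbers turns this mass into `d a` times the mass of the prefix. So `ρ` is
a multiple of the product measure (`Exchangeable.eq_smul_productLaw`), and it vanishes on the
complement of `A`.

*Ergodic exchangeable measures are products.* If `μ` is ergodic, the density with respect to `μ` of
an exchangeable measure `ρ ≪ μ` is invariant under the countable group of finitary permutations,
so `ρ` is a multiple of `μ` (`PermErgodic.eq_smul_of_absolutelyContinuous`). This applies to the
law of the sequence without its first letter, restricted to the event that this letter is `a`,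
because it is exchangeable and at most the law of the shifted sequence, which is `μ`
(`map_shift_eq`). So the first letter is independent of the rest, whose law is again `μ`, and
induction on the length of a word gives the product formula (`PermErgodic.exists_eq_productLaw`).

The letter frequencies come from the strong law of large numbers, and they separate the measures
that belong to different vectors.
-/

/-! ### Exchangeable measures on sequences of letters -/

/-- The permutations of `ℕ` that fix all but finitely many numbers. -/
def finitaryPerm : Subgroup (Equiv.Perm ℕ) where
  carrier := {g | ∃ N, ∀ j, N ≤ j → g j = j}
  one_mem' := ⟨0, fun _ _ => rfl⟩
  mul_mem' := by
    rintro g h ⟨N, hg⟩ ⟨M, hh⟩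
    refine ⟨max N M, fun j hj => ?_⟩
    rw [Equiv.Perm.mul_apply, hh j (le_trans (le_max_right _ _) hj),
      hg j (le_trans (le_max_left _ _) hj)]
  inv_mem' := by
    rintro g ⟨N, hg⟩
    exact ⟨N, fun j hj => by rw [Equiv.Perm.inv_eq_iff_eq, hg j hj]⟩

instance : Countable finitaryPerm := by
  -- a finitary permutation is determined by its finitely supported displacement
  have hfin : ∀ g : finitaryPerm, (Function.support fun j => ((g.1 j : ℤ) - j)).Finite := by
    rintro ⟨g, N, hg⟩
    refine (Set.finite_Iio N).subset fun j hj => ?_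
    by_contra h
    exact hj (by simp [hg j (not_lt.mp h)])
  refine Function.Injective.countable
    (f := fun g : finitaryPerm => (Finsupp.ofSupportFinite _ (hfin g) : ℕ →₀ ℤ)) ?_
  intro g h hgh
  ext j
  have := DFunLike.congr_fun hgh j
  change (g.1 j : ℤ) - j = (h.1 j : ℤ) - j at this
  omega

/-- The sequences that agree with `w` at the first `n` places. -/
def prefixCylinder (n : ℕ) (w : ℕ → ℕ) : Set (ℕ → ℕ) := {ω | ∀ j < n, ω j = w j}

/-- The number of occurrences of each letter among the first `n` letters of `ω`. -/
noncomputable def letterCount (n : ℕ) (ω : ℕ → ℕ) : ℕ →₀ ℕ :=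
  ∑ j ∈ Finset.range n, Finsupp.single (ω j) 1

theorem letterCount_succ (n : ℕ) (ω : ℕ → ℕ) :
    letterCount (n + 1) ω = letterCount n ω + Finsupp.single (ω n) 1 :=
  Finset.sum_range_succ _ _

theorem letterCount_congr {n : ℕ} {ω ω' : ℕ → ℕ} (h : ∀ j < n, ω j = ω' j) :
    letterCount n ω = letterCount n ω' :=
  Finset.sum_congr rfl fun j hj => by rw [h j (Finset.mem_range.mp hj)]

theorem letterCount_sum (n : ℕ) (ω : ℕ → ℕ) : ((letterCount n ω).sum fun _ k => k) = n := by
  induction n with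
  | zero => simp [letterCount]
  | succ n ih => rw [letterCount_succ, PascalVertex.sum_add_single, ih]

theorem letterCount_apply (n : ℕ) (ω : ℕ → ℕ) (i : ℕ) :
    (letterCount n ω i : ℝ) = ∑ j ∈ Finset.range n, if ω j = i then (1 : ℝ) else 0 := by
  induction n with
  | zero => simp [letterCount]
  | succ n ih =>
    rw [letterCount_succ, Finset.sum_range_succ, ← ih, Finsupp.add_apply, Finsupp.single_apply]
    push_cast
    rfl

theorem letterCount_comp {n : ℕ} {g : Equiv.Perm ℕ} (hg : ∀ j, n ≤ j → g j = j) (ω : ℕ → ℕ) :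
    letterCount n (ω ∘ g) = letterCount n ω := by
  refine Finset.sum_equiv g (fun j => ?_) fun _ _ => rfl
  simp only [Finset.mem_range]
  rcases lt_or_ge j n with h | h
  · refine ⟨fun _ => ?_, fun _ => h⟩
    by_contra h'
    have h2 := g.injective (hg _ (not_lt.mp h'))
    omega
  · rw [hg j h]

/-- Sequences with the same letter count at time `n` and the same letters from then on differ by
a finitary permutation. -/
theorem exists_finitaryPerm_of_letterCount_eq {n : ℕ} {ω ω' : ℕ → ℕ}
    (h : letterCount n ω = letterCount n ω') (htail : ∀ j, n ≤ j → ω j = ω' j) :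
    ∃ g ∈ finitaryPerm, ω' = ω ∘ g := by
  have hcard : ∀ (u : ℕ → ℕ) (i : ℕ), letterCount n u i = Nat.card {j : Fin n // u j = i} := by
    intro u i
    rw [Nat.card_eq_fintype_card, Fintype.card_subtype, Finset.card_filter,
      Fin.sum_univ_eq_sum_range (fun j => if u j = i then 1 else 0)]
    simp [letterCount, Finsupp.single_apply]
  -- the permutation matches the places of each letter
  have hfib : ∀ i, Nonempty ({j : Fin n // ω' j = i} ≃ {j : Fin n // ω j = i}) := fun i =>
    Finite.card_eq.mp (by rw [← hcard, ← hcard, h])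
  let σ : Equiv.Perm (Fin n) :=
    Equiv.ofFiberEquiv (f := fun j : Fin n => ω' j) (g := fun j : Fin n => ω j)
      fun i => (hfib i).some
  have hσ : ∀ j, ω (σ j) = ω' j := fun j => Equiv.ofFiberEquiv_map (f := fun j : Fin n => ω' j)
    (g := fun j : Fin n => ω j) _ j
  refine ⟨σ.extendDomain (Fin.equivSubtype (n := n)), ⟨n, fun j hj => ?_⟩, ?_⟩
  · exact Equiv.Perm.extendDomain_apply_not_subtype _ _ (by omega)
  · funext j
    rcases lt_or_ge j n with hj | hj
    · have h1 := hσ ⟨j, hj⟩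
      rw [Function.comp_apply, Equiv.Perm.extendDomain_apply_subtype σ Fin.equivSubtype hj]
      exact h1.symm
    · rw [Function.comp_apply, Equiv.Perm.extendDomain_apply_not_subtype _ _ (by omega)]
      exact (htail j hj).symm

theorem measurableSet_letter_eq (j a : ℕ) : MeasurableSet {ω : ℕ → ℕ | ω j = a} :=
  (measurableSet_singleton a).preimage (measurable_pi_apply j)

theorem measurableSet_prefixCylinder (n : ℕ) (w : ℕ → ℕ) :
    MeasurableSet (prefixCylinder n w) := by
  have : prefixCylinder n w = ⋂ j, ⋂ (_ : j < n), (fun ω : ℕ → ℕ => ω j) ⁻¹' {w j} := by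
    ext ω; simp [prefixCylinder]
  rw [this]
  exact .iInter fun j => .iInter fun _ => measurable_pi_apply j (measurableSet_singleton _)

/-- Extend a word by the letter `0`. -/
def extendWord {K : ℕ} (u : Fin K → ℕ) (j : ℕ) : ℕ := if h : j < K then u ⟨j, h⟩ else 0

theorem iUnion_prefixCylinder (K : ℕ) :
    ⋃ u : Fin K → ℕ, prefixCylinder K (extendWord u) = Set.univ := by
  refine Set.eq_univ_of_forall fun ω => Set.mem_iUnion.mpr ⟨fun j => ω j, fun j hj => ?_⟩
  simp [extendWord, hj]

theorem pairwise_disjoint_prefixCylinder (K : ℕ) :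
    Pairwise (Function.onFun Disjoint
      fun u : Fin K → ℕ => prefixCylinder K (extendWord u)) := by
  intro u v huv
  refine Set.disjoint_left.mpr fun ω hu hv => huv (funext fun j => ?_)
  have h1 := hu j j.2
  have h2 := hv j j.2
  simp only [extendWord, j.2, dif_pos] at h1 h2
  exact h1.symm.trans h2

theorem generateFrom_prefixCylinder (K : ℕ) :
    (MeasurableSpace.pi : MeasurableSpace (ℕ → ℕ)) =
      MeasurableSpace.generateFrom {A | ∃ n w, K ≤ n ∧ A = prefixCylinder n w} := by
  refine le_antisymm ?_ (MeasurableSpace.generateFrom_le ?_)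
  · refine iSup_le fun i => ?_
    rw [← measurable_iff_comap_le]
    refine @measurable_to_countable' _ _ _ _ (_) _ fun a => ?_
    have : (fun ω : ℕ → ℕ => ω i) ⁻¹' {a} =
        ⋃ u : {u : Fin (max K (i + 1)) → ℕ // extendWord u i = a},
          prefixCylinder (max K (i + 1)) (extendWord u.1) := by
      ext ω
      simp only [Set.mem_preimage, Set.mem_singleton_iff, Set.mem_iUnion]
      constructor
      · intro h
        refine ⟨⟨fun j => ω j, ?_⟩, fun j hj => ?_⟩
        · simp [extendWord, h]
        · simp only [extendWord, hj, dif_pos]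
      · rintro ⟨u, hu⟩
        rw [hu i (lt_of_lt_of_le (Nat.lt_succ_self i) (le_max_right _ _)), u.2]
    rw [this]
    exact MeasurableSet.iUnion fun u =>
      MeasurableSpace.measurableSet_generateFrom ⟨_, _, le_max_left _ _, rfl⟩
  · rintro _ ⟨n, w, -, rfl⟩
    exact measurableSet_prefixCylinder n w

theorem isPiSystem_prefixCylinder (K : ℕ) :
    IsPiSystem {A | ∃ n w, K ≤ n ∧ A = prefixCylinder n w} := by
  have key : ∀ n w m v, n ≤ m → (prefixCylinder n w ∩ prefixCylinder m v).Nonempty →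
      prefixCylinder n w ∩ prefixCylinder m v = prefixCylinder m v := by
    rintro n w m v hnm ⟨ω, h1, h2⟩
    refine Set.inter_eq_right.mpr fun ω' h' j hj => ?_
    rw [h' j (hj.trans_le hnm), ← h2 j (hj.trans_le hnm), h1 j hj]
  rintro _ ⟨n, w, hn, rfl⟩ _ ⟨m, v, hm, rfl⟩ hne
  rcases le_total n m with h | h
  · exact ⟨m, v, hm, key _ _ _ _ h hne⟩
  · rw [Set.inter_comm] at hne ⊢
    exact ⟨n, w, hn, key _ _ _ _ h hne⟩

/-- Only long cylinders are needed: the mass of the whole space is the sum of the masses of the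
cylinders of length `K`. -/
theorem ext_of_prefixCylinder (K : ℕ) {μ ν : Measure (ℕ → ℕ)} [IsFiniteMeasure μ]
    (h : ∀ n w, K ≤ n → μ (prefixCylinder n w) = ν (prefixCylinder n w)) : μ = ν := by
  refine ext_of_generate_finite _ (generateFrom_prefixCylinder K) (isPiSystem_prefixCylinder K)
    ?_ ?_
  · rintro _ ⟨n, w, hn, rfl⟩
    exact h n w hn
  · rw [← iUnion_prefixCylinder K,
      measure_iUnion (pairwise_disjoint_prefixCylinder K)
        (fun _ => measurableSet_prefixCylinder _ _),
      measure_iUnion (pairwise_disjoint_prefixCylinder K)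
        (fun _ => measurableSet_prefixCylinder _ _)]
    exact tsum_congr fun u => h _ _ le_rfl

/-- A measure on sequences of letters is exchangeable if it is invariant under all finitary
permutations of the places. -/
def Exchangeable (μ : Measure (ℕ → ℕ)) : Prop :=
  ∀ g ∈ finitaryPerm, μ.map (fun ω => ω ∘ g) = μ

theorem measurable_comp_perm (g : ℕ → ℕ) : Measurable fun ω : ℕ → ℕ => ω ∘ g :=
  measurable_pi_lambda _ fun j => measurable_pi_apply (g j)

theorem Exchangeable.measure_preimage {μ : Measure (ℕ → ℕ)} (h : Exchangeable μ)
    {g : Equiv.Perm ℕ} (hg : g ∈ finitaryPerm) {A : Set (ℕ → ℕ)} (hA : MeasurableSet A) :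
    μ ((fun ω => ω ∘ g) ⁻¹' A) = μ A := by
  rw [← Measure.map_apply (measurable_comp_perm g) hA, h g hg]

theorem exchangeable_of_prefixCylinder (K : ℕ) {μ : Measure (ℕ → ℕ)} [IsFiniteMeasure μ]
    (h : ∀ n w v, K ≤ n → letterCount n w = letterCount n v →
      μ (prefixCylinder n w) = μ (prefixCylinder n v)) : Exchangeable μ := by
  rintro g ⟨N, hN⟩
  refine (ext_of_prefixCylinder (max K N) fun n w hn => ?_).symm
  rw [Measure.map_apply (measurable_comp_perm g) (measurableSet_prefixCylinder n w)]
  have hgn : ∀ j, n ≤ j → g j = j := fun j hj =>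
    hN j (le_trans (le_trans (le_max_right _ _) hn) hj)
  have hlt : ∀ j, j < n → g j < n := fun j hj => by
    by_contra h'
    have h2 := g.injective (hgn _ (not_lt.mp h'))
    omega
  have hlt' : ∀ j, j < n → g.symm j < n := fun j hj => by
    by_contra h'
    have h2 := hgn _ (not_lt.mp h')
    rw [Equiv.apply_symm_apply] at h2
    omega
  have : (fun ω : ℕ → ℕ => ω ∘ g) ⁻¹' prefixCylinder n w = prefixCylinder n (w ∘ g.symm) := by
    ext ω
    constructor
    · intro hω j hj
      have := hω _ (hlt' j hj)
      simpa using this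
    · intro hω j hj
      have := hω _ (hlt j hj)
      simpa using this
  rw [this]
  refine h n w _ (le_trans (le_max_left _ _) hn) (letterCount_comp (fun j hj => ?_) w).symm
  rw [Equiv.symm_apply_eq, hgn j hj]

/-- A measure on sequences of letters is ergodic for the finitary permutations. -/
def PermErgodic (μ : Measure (ℕ → ℕ)) : Prop :=
  ∀ A : Set (ℕ → ℕ), MeasurableSet A → (∀ g ∈ finitaryPerm, ∀ ω ∈ A, ω ∘ g ∈ A) →
    μ A = 0 ∨ μ Aᶜ = 0

/-- An ergodic exchangeable measure is extreme: the density of an exchangeable measure with respect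
to it is invariant under a countable group, hence constant. -/
theorem PermErgodic.eq_smul_of_absolutelyContinuous {μ ρ : Measure (ℕ → ℕ)}
    [IsProbabilityMeasure μ] [IsFiniteMeasure ρ] (hμ : Exchangeable μ) (he : PermErgodic μ)
    (hρ : Exchangeable ρ) (hac : ρ ≪ μ) : ρ = ρ Set.univ • μ := by
  obtain ⟨c, hc⟩ : ∃ c, ρ.rnDeriv μ =ᵐ[μ] Function.const _ c := by
    refine exists_eventuallyEq_const_of_forall_separating MeasurableSet fun U hU => ?_
    set A₀ := ρ.rnDeriv μ ⁻¹' U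
    have hA₀ : MeasurableSet A₀ := Measure.measurable_rnDeriv _ _ hU
    -- the largest invariant subset of `A₀` differs from it by a null set
    set A := ⋂ g : finitaryPerm, (fun ω : ℕ → ℕ => ω ∘ g.1) ⁻¹' A₀
    have hA : MeasurableSet A := .iInter fun g => measurable_comp_perm _ hA₀
    have hAA₀ : ∀ᵐ ω ∂μ, ω ∈ A ↔ ω ∈ A₀ := by
      have : ∀ᵐ ω ∂μ, ∀ g : finitaryPerm, ρ.rnDeriv μ (ω ∘ g.1) = ρ.rnDeriv μ ω := by
        rw [ae_all_iff]
        rintro ⟨g, hg⟩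
        exact MeasurePreserving.rnDeriv_comp_aeEq ⟨measurable_comp_perm g, hρ g hg⟩
          ⟨measurable_comp_perm g, hμ g hg⟩
      filter_upwards [this] with ω hω
      simp [A, A₀, hω]
    have hinv : ∀ g ∈ finitaryPerm, ∀ ω ∈ A, ω ∘ g ∈ A := by
      intro g hg ω hω
      refine Set.mem_iInter.mpr fun h => ?_
      exact Set.mem_iInter.mp hω ⟨g * h.1, mul_mem hg h.2⟩
    rcases he A hA hinv with h | h
    · right
      filter_upwards [hAA₀, measure_eq_zero_iff_ae_notMem.mp h] with ω h1 h2 h3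
      exact h2 (h1.mpr h3)
    · left
      filter_upwards [hAA₀, measure_eq_zero_iff_ae_notMem.mp h] with ω h1 h2
      exact h1.mp (by simpa using h2)
  have h1 : ρ = c • μ := by
    rw [← Measure.withDensity_rnDeriv_eq ρ μ hac, withDensity_congr_ae hc]
    exact withDensity_const c
  rw [h1]
  simp

/-! ### Product measures -/

/-- The probability measure on `ℕ` with weights `d`. -/
noncomputable def letterLaw (d : ProbVector) : Measure ℕ :=
  Measure.sum fun i => ENNReal.ofReal (d.1 i) • Measure.dirac i

theorem letterLaw_singleton (d : ProbVector) (i : ℕ) :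
    letterLaw d {i} = ENNReal.ofReal (d.1 i) :=
  Measure.sum_smul_dirac_singleton

instance (d : ProbVector) : IsProbabilityMeasure (letterLaw d) := by
  constructor
  rw [letterLaw, Measure.sum_apply _ MeasurableSet.univ]
  simp only [Measure.smul_apply, measure_univ, smul_eq_mul, mul_one]
  rw [← ENNReal.ofReal_tsum_of_nonneg d.2.1 d.2.2.summable, d.2.2.tsum_eq, ENNReal.ofReal_one]

/-- The law of a sequence of independent letters with distribution `d`. -/
noncomputable def productLaw (d : ProbVector) : Measure (ℕ → ℕ) :=
  Measure.infinitePi fun _ => letterLaw d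

instance (d : ProbVector) : IsProbabilityMeasure (productLaw d) := by
  unfold productLaw; infer_instance

theorem pascalWeight_letterCount (d : ProbVector) (n : ℕ) (w : ℕ → ℕ) :
    pascalWeight d (letterCount n w) = ∏ j ∈ Finset.range n, d.1 (w j) := by
  induction n with
  | zero => simp [letterCount, pascalWeight]
  | succ n ih =>
    rw [letterCount_succ, Finset.prod_range_succ, ← ih]
    refine (Finsupp.prod_add_index' (h := fun i k => d.1 i ^ k) (fun i => pow_zero (d.1 i))
      (fun i => pow_add (d.1 i))).trans ?_
    congr 1
    exact (Finsupp.prod_single_index (h := fun i k => d.1 i ^ k) (pow_zero (d.1 _))).trans (pow_one _)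

theorem productLaw_prefixCylinder (d : ProbVector) (n : ℕ) (w : ℕ → ℕ) :
    productLaw d (prefixCylinder n w) = ENNReal.ofReal (pascalWeight d (letterCount n w)) := by
  have : prefixCylinder n w = Set.pi (Finset.range n) fun j => {w j} := by
    ext ω; simp [prefixCylinder]
  rw [this, productLaw, Measure.infinitePi_pi _ (fun _ _ => measurableSet_singleton _),
    pascalWeight_letterCount, ENNReal.ofReal_prod_of_nonneg fun _ _ => d.2.1 _]
  exact Finset.prod_congr rfl fun j _ => letterLaw_singleton d _

theorem exchangeable_productLaw (d : ProbVector) : Exchangeable (productLaw d) :=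
  exchangeable_of_prefixCylinder 0 fun n w v _ h => by
    rw [productLaw_prefixCylinder, productLaw_prefixCylinder, h]

/-- The law of large numbers for the letter `a`, with the first `k` letters dropped. -/
theorem productLaw_tendsto_frequency (d : ProbVector) (a k : ℕ) :
    ∀ᵐ ω ∂productLaw d, Tendsto
      (fun n : ℕ => (∑ j ∈ Finset.range n, if ω (k + j) = a then (1 : ℝ) else 0) / n)
      atTop (𝓝 (d.1 a)) := by
  set φ : ℕ → ℝ := fun b => if b = a then 1 else 0
  have hφ : Measurable φ := measurable_of_countable _
  have hφi : φ = Set.indicator {a} 1 := by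
    ext b
    simp [φ, Set.indicator_apply]
  have heval : ∀ m, MeasurePreserving (fun ω : ℕ → ℕ => ω m) (productLaw d) (letterLaw d) :=
    fun m => measurePreserving_eval_infinitePi (fun _ => letterLaw d) m
  have hint : Integrable φ (letterLaw d) := by
    rw [hφi]
    exact (integrable_indicator_iff (measurableSet_singleton a)).mpr (integrable_const 1).integrableOn
  have hindep : ProbabilityTheory.iIndepFun (fun m (ω : ℕ → ℕ) => φ (ω m)) (productLaw d) :=
    ProbabilityTheory.iIndepFun_infinitePi (P := fun _ => letterLaw d) (X := fun _ => φ)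
      (fun _ => hφ)
  have hident : ∀ m m', ProbabilityTheory.IdentDistrib (fun ω : ℕ → ℕ => φ (ω m))
      (fun ω : ℕ → ℕ => φ (ω m')) (productLaw d) (productLaw d) := fun m m' =>
    ⟨(hφ.comp (heval m).measurable).aemeasurable, (hφ.comp (heval m').measurable).aemeasurable, by
      change Measure.map (φ ∘ fun ω : ℕ → ℕ => ω m) _ = Measure.map (φ ∘ fun ω : ℕ → ℕ => ω m') _
      rw [← Measure.map_map hφ (heval m).measurable, ← Measure.map_map hφ (heval m').measurable,
        (heval m).map_eq, (heval m').map_eq]⟩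
  have hmean : ∫ ω, φ (ω (k + 0)) ∂productLaw d = d.1 a := by
    have h1 := integral_map (heval (k + 0)).measurable.aemeasurable (f := φ)
      (hφ.aestronglyMeasurable (μ := (productLaw d).map fun ω : ℕ → ℕ => ω (k + 0)))
    rw [← h1, (heval (k + 0)).map_eq, hφi, integral_indicator_one (measurableSet_singleton a),
      Measure.real, letterLaw_singleton]
    exact ENNReal.toReal_ofReal (d.2.1 a)
  have := ProbabilityTheory.strong_law_ae_real (μ := productLaw d)
    (fun j ω => φ (ω (k + j))) ((heval (k + 0)).integrable_comp_of_integrable hint)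
    (fun i j hij => hindep.indepFun (by omega)) (fun i => hident _ _)
  rw [hmean] at this
  exact this

/-- A finite exchangeable measure under which almost every sequence has letter frequencies `d` is
a multiple of the product measure. By exchangeability, the letter following a given prefix may be
replaced by a letter at any later place, hence by its limiting frequency. -/
theorem Exchangeable.eq_smul_productLaw {ρ : Measure (ℕ → ℕ)} [IsFiniteMeasure ρ]
    (hρ : Exchangeable ρ) {d : ProbVector} (hac : ρ ≪ productLaw d) :
    ρ = ρ Set.univ • productLaw d := by
  have hstep : ∀ n w, ρ.real (prefixCylinder (n + 1) w) =
      d.1 (w n) * ρ.real (prefixCylinder n w) := by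
    intro n w
    set C := prefixCylinder n w
    have hC : MeasurableSet C := measurableSet_prefixCylinder n w
    have hE : ∀ j, MeasurableSet {ω : ℕ → ℕ | ω j = w n} := fun j =>
      measurableSet_letter_eq j (w n)
    have hsucc : prefixCylinder (n + 1) w = {ω | ω n = w n} ∩ C := by
      ext ω
      simp only [prefixCylinder, Set.mem_ofPred_eq, Set.mem_inter_iff, C, Nat.lt_succ_iff_lt_or_eq]
      constructor
      · exact fun h => ⟨h n (.inr rfl), fun j hj => h j (.inl hj)⟩
      · rintro ⟨h1, h2⟩ j (hj | rfl)
        exacts [h2 j hj, h1]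
    -- swapping the places `n` and `n + j` does not affect the prefix
    have hmove : ∀ j, ρ.real ({ω | ω (n + j) = w n} ∩ C) = ρ.real (prefixCylinder (n + 1) w) := by
      intro j
      have hg : Equiv.swap n (n + j) ∈ finitaryPerm :=
        ⟨n + j + 1, fun i hi => Equiv.swap_apply_of_ne_of_ne (by omega) (by omega)⟩
      rw [hsucc, Measure.real, Measure.real, ← hρ.measure_preimage hg ((hE n).inter hC)]
      congr 2
      ext ω
      simp only [Set.mem_inter_iff, Set.mem_ofPred_eq, Set.mem_preimage, Function.comp_apply,
        Equiv.swap_apply_left]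
      refine and_congr_right fun _ => forall₂_congr fun i hi => ?_
      rw [Function.comp_apply, Equiv.swap_apply_of_ne_of_ne (by omega) (by omega)]
    set F : ℕ → (ℕ → ℕ) → ℝ := fun N ω =>
      (∑ j ∈ Finset.range N, if ω (n + j) = w n then (1 : ℝ) else 0) / N
    have hind : ∀ j, (fun ω : ℕ → ℕ => if ω (n + j) = w n then (1 : ℝ) else 0) =
        Set.indicator {ω | ω (n + j) = w n} 1 := by
      intro j
      ext ω
      simp [Set.indicator_apply]
    have hmeas : ∀ N, Measurable (F N) := fun N =>
      (Finset.measurable_sum _ fun j _ => by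
        rw [hind]
        exact measurable_one.indicator (hE _)).div_const _
    have hlim : Tendsto (fun N => ∫ ω in C, F N ω ∂ρ) atTop (𝓝 (∫ ω in C, d.1 (w n) ∂ρ)) := by
      refine tendsto_integral_of_dominated_convergence (fun _ => 1)
        (fun N => (hmeas N).aestronglyMeasurable) (integrable_const _) (fun N => ?_) ?_
      · refine .of_forall fun ω => ?_
        have h0 : 0 ≤ ∑ j ∈ Finset.range N, if ω (n + j) = w n then (1 : ℝ) else 0 :=
          Finset.sum_nonneg fun _ _ => by split_ifs <;> norm_num
        have h1 : (∑ j ∈ Finset.range N, if ω (n + j) = w n then (1 : ℝ) else 0) ≤ N := by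
          calc _ ≤ ∑ j ∈ Finset.range N, (1 : ℝ) :=
                Finset.sum_le_sum fun _ _ => by split_ifs <;> norm_num
            _ = N := by simp
        rw [Real.norm_of_nonneg (div_nonneg h0 N.cast_nonneg)]
        exact div_le_one_of_le₀ h1 N.cast_nonneg
      · exact ae_restrict_of_ae (hac.ae_le (productLaw_tendsto_frequency d (w n) n))
    have hconst : ∀ᶠ N in atTop, ∫ ω in C, F N ω ∂ρ = ρ.real (prefixCylinder (n + 1) w) := by
      filter_upwards [eventually_gt_atTop 0] with N hN
      have hN' : (N : ℝ) ≠ 0 := by positivity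
      rw [integral_div, integral_finsetSum]
      · rw [Finset.sum_congr rfl fun j _ => by
          rw [hind j, integral_indicator_one (hE _), measureReal_restrict_apply (hE _), hmove j]]
        simp [hN']
      · intro j _
        rw [hind]
        exact (integrable_indicator_iff (hE _)).mpr (integrable_const 1).integrableOn
    have := tendsto_nhds_unique (hlim.congr' hconst) tendsto_const_nhds
    rw [← this]
    simp [Measure.real, mul_comm]
  refine ext_of_prefixCylinder 0 fun n w _ => ?_
  rw [Measure.smul_apply, productLaw_prefixCylinder, pascalWeight_letterCount, smul_eq_mul,
    ← ENNReal.toReal_eq_toReal_iff' (measure_ne_top _ _) (by finiteness), ENNReal.toReal_mul,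
    ENNReal.toReal_ofReal (Finset.prod_nonneg fun _ _ => d.2.1 _)]
  change ρ.real _ = ρ.real _ * _
  clear hac
  induction n with
  | zero => simp [prefixCylinder]
  | succ n ih => rw [hstep, ih (Nat.zero_le _), Finset.prod_range_succ]; ring

theorem permErgodic_productLaw (d : ProbVector) : PermErgodic (productLaw d) := by
  intro A hA hinv
  have hA' : ∀ g ∈ finitaryPerm, (fun ω : ℕ → ℕ => ω ∘ g) ⁻¹' A = A := by
    intro g hg
    ext ω
    refine ⟨fun h => ?_, fun h => hinv g hg ω h⟩
    have := hinv g⁻¹ (inv_mem hg) _ h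
    convert this using 1
    ext j
    simp
  have hex : Exchangeable ((productLaw d).restrict A) := by
    intro g hg
    conv_lhs => rw [← hA' g hg]
    rw [← Measure.restrict_map (measurable_comp_perm g) hA, exchangeable_productLaw d g hg]
  have h := congrArg (fun ρ => ρ Aᶜ)
    (hex.eq_smul_productLaw (d := d) Measure.absolutelyContinuous_restrict)
  simpa [Measure.restrict_apply hA.compl] using h

/-! ### Ergodic exchangeable measures are product measures -/

/-- The sequence `w` preceded by the letter `a`. -/
def consLetter (a : ℕ) (w : ℕ → ℕ) : ℕ → ℕ
  | 0 => a
  | j + 1 => w j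

theorem letterCount_consLetter (a n : ℕ) (w : ℕ → ℕ) :
    letterCount (n + 1) (consLetter a w) = letterCount n w + Finsupp.single a 1 :=
  Finset.sum_range_succ' _ _

theorem measurable_shift : Measurable fun (ω : ℕ → ℕ) (j : ℕ) => ω (j + 1) :=
  measurable_comp_perm fun j => j + 1

theorem prefixCylinder_consLetter (a n : ℕ) (w : ℕ → ℕ) :
    prefixCylinder (n + 1) (consLetter a w) =
      (fun (ω : ℕ → ℕ) (j : ℕ) => ω (j + 1)) ⁻¹' prefixCylinder n w ∩ {ω | ω 0 = a} := by
  ext ω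
  constructor
  · exact fun h => ⟨fun j hj => h (j + 1) (by omega), h 0 (by omega)⟩
  · rintro ⟨h1, h2⟩ (_ | j) hj
    exacts [h2, h1 j (by omega)]

/-- Exchangeability implies invariance under the shift. -/
theorem map_shift_eq (K : ℕ) {μ : Measure (ℕ → ℕ)} [IsFiniteMeasure μ]
    (h : ∀ n w v, K ≤ n → letterCount n w = letterCount n v →
      μ (prefixCylinder n w) = μ (prefixCylinder n v)) :
    μ.map (fun (ω : ℕ → ℕ) (j : ℕ) => ω (j + 1)) = μ := by
  refine ext_of_prefixCylinder K fun n w hn => ?_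
  rw [Measure.map_apply measurable_shift (measurableSet_prefixCylinder n w)]
  have hE : ∀ i, ⋃ a, {ω : ℕ → ℕ | ω i = a} = Set.univ := fun i =>
    Set.eq_univ_of_forall fun ω => Set.mem_iUnion.mpr ⟨ω i, rfl⟩
  have hsplit : ∀ (i : ℕ) (S : Set (ℕ → ℕ)), MeasurableSet S →
      μ S = ∑' a, μ (S ∩ {ω | ω i = a}) := by
    intro i S hS
    conv_lhs => rw [← Set.inter_univ S, ← hE i, Set.inter_iUnion]
    refine measure_iUnion (fun a b hab => Set.disjoint_left.mpr ?_) fun a =>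
      hS.inter (measurableSet_letter_eq i a)
    rintro ω ⟨-, h1⟩ ⟨-, h2⟩
    exact hab (h1.symm.trans h2)
  -- summing over the letter in front of a word, or over the one behind it, gives the same
  rw [hsplit 0 _ (measurable_shift (measurableSet_prefixCylinder n w)),
    hsplit n _ (measurableSet_prefixCylinder n w)]
  refine tsum_congr fun a => ?_
  have hsnoc : prefixCylinder n w ∩ {ω | ω n = a} =
      prefixCylinder (n + 1) (Function.update w n a) := by
    ext ω
    constructor
    · rintro ⟨h1, h2⟩ j hj
      rcases Nat.lt_succ_iff_lt_or_eq.mp hj with hj | rfl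
      · rw [Function.update_of_ne hj.ne, h1 j hj]
      · rw [Function.update_self]; exact h2
    · intro h1
      refine ⟨fun j hj => ?_, ?_⟩
      · rw [h1 j (by omega), Function.update_of_ne hj.ne]
      · have := h1 n (by omega)
        rwa [Function.update_self] at this
  rw [← prefixCylinder_consLetter, hsnoc]
  refine h _ _ _ (by omega) ?_
  rw [letterCount_consLetter, letterCount_succ, Function.update_self]
  congr 1
  exact letterCount_congr fun j hj => by rw [Function.update_of_ne hj.ne]

/-- Conditioning an ergodic exchangeable measure on its first letter and deleting that letter
produces an exchangeable measure dominated by the original one, hence proportional to it. So the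
first letter is independent of the others, and the measure is a product measure. -/
theorem PermErgodic.exists_eq_productLaw (K : ℕ) {μ : Measure (ℕ → ℕ)} [IsProbabilityMeasure μ]
    (h : ∀ n w v, K ≤ n → letterCount n w = letterCount n v →
      μ (prefixCylinder n w) = μ (prefixCylinder n v)) (he : PermErgodic μ) :
    ∃ d, productLaw d = μ := by
  have hE : ∀ a, MeasurableSet {ω : ℕ → ℕ | ω 0 = a} := fun a =>
    measurableSet_letter_eq 0 a
  have hsum : HasSum (fun a => μ.real {ω : ℕ → ℕ | ω 0 = a}) 1 := by
    have h1 := measure_iUnion (μ := μ) (f := fun a => {ω : ℕ → ℕ | ω 0 = a})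
      (fun a b hab => Set.disjoint_left.mpr fun ω h1 h2 => hab (h1.symm.trans h2)) hE
    have h2 : ⋃ a, {ω : ℕ → ℕ | ω 0 = a} = Set.univ :=
      Set.eq_univ_of_forall fun ω => Set.mem_iUnion.mpr ⟨ω 0, rfl⟩
    rw [h2, measure_univ] at h1
    have h3 := ENNReal.hasSum_toReal (f := fun a => μ {ω : ℕ → ℕ | ω 0 = a})
      (by rw [← h1]; exact ENNReal.one_ne_top)
    rwa [← ENNReal.tsum_toReal_eq fun _ => measure_ne_top _ _, ← h1, ENNReal.toReal_one] at h3
  let d : ProbVector := ⟨fun a => μ.real {ω : ℕ → ℕ | ω 0 = a}, fun a => measureReal_nonneg, hsum⟩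
  refine ⟨d, ?_⟩
  set ρ : ℕ → Measure (ℕ → ℕ) := fun a =>
    (μ.restrict {ω | ω 0 = a}).map (fun (ω : ℕ → ℕ) (j : ℕ) => ω (j + 1))
  have hρ : ∀ a n w, ρ a (prefixCylinder n w) = μ (prefixCylinder (n + 1) (consLetter a w)) := by
    intro a n w
    rw [prefixCylinder_consLetter, Measure.map_apply measurable_shift
      (measurableSet_prefixCylinder n w), Measure.restrict_apply
      (measurable_shift (measurableSet_prefixCylinder n w))]
  have hfin : ∀ a, IsFiniteMeasure (ρ a) := fun a => inferInstance
  have hle : ∀ a, ρ a ≤ μ := by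
    intro a
    conv_rhs => rw [← map_shift_eq K h]
    exact Measure.map_mono Measure.restrict_le_self measurable_shift
  have hprod : ∀ a, ρ a = μ {ω | ω 0 = a} • μ := by
    intro a
    have h1 := he.eq_smul_of_absolutelyContinuous (exchangeable_of_prefixCylinder K h)
      (exchangeable_of_prefixCylinder (μ := ρ a) K fun n w v hn hwv => by
        rw [hρ, hρ]
        exact h _ _ _ (by omega) (by rw [letterCount_consLetter, letterCount_consLetter, hwv]))
      (hle a).absolutelyContinuous
    rw [h1]
    congr 1
    rw [Measure.map_apply measurable_shift MeasurableSet.univ]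
    simp
  refine ext_of_prefixCylinder 0 fun n w _ => ?_
  rw [productLaw_prefixCylinder, pascalWeight_letterCount,
    ENNReal.ofReal_prod_of_nonneg fun _ _ => d.2.1 _]
  induction n generalizing w with
  | zero => simp [prefixCylinder]
  | succ n ih =>
    have hw : w = consLetter (w 0) fun j => w (j + 1) := by
      ext j
      cases j <;> rfl
    rw [Finset.prod_range_succ', ih (fun j => w (j + 1)) (Nat.zero_le _)]
    conv_rhs => rw [hw, ← hρ, hprod, Measure.smul_apply, smul_eq_mul, mul_comm]
    congr 1
    exact ofReal_measureReal

/-! ### Paths of the Pascal diagram as sequences of letters -/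

open GenBratteliDiagram

/-- The path whose vertices count the letters of `ω`. Its first vertex is given by the letter
`ω 0`, and its edge with index `n` adds the letter `ω (n + 1)`. -/
noncomputable def pathOfLetters (ω : ℕ → ℕ) : pascalDiagram.PathSpace :=
  ⟨fun n => ⟨(⟨letterCount (n + 1) ω, letterCount_sum _ ω⟩,
    ⟨letterCount (n + 1 + 1) ω, letterCount_sum _ ω⟩), ω (n + 1), letterCount_succ _ _⟩,
    fun _ => rfl⟩

theorem PascalVertex.exists_eq_single (v : PascalVertex 1) :
    ∃ i, v.1 = Finsupp.single i 1 :=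
  (Finsupp.sum_eq_one_iff v.1).mp v.2

/-- The sequence of letters added along a path. -/
noncomputable def lettersOfPath (x : pascalDiagram.PathSpace) : ℕ → ℕ
  | 0 => (PascalVertex.exists_eq_single (x.1 0).1.1).choose
  | n + 1 => (x.1 n).2.choose

/-- The beginning of an infinite path. -/
def pathPrefix (x : pascalDiagram.PathSpace) (n : ℕ) : pascalDiagram.FinPath n :=
  ⟨fun i _ => x.1 i, fun i _ => x.2 i⟩

/-- A finite path is determined by its letters. -/
theorem finPath_edge_eq {n : ℕ} (e : pascalDiagram.FinPath n) (w : ℕ → ℕ)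
    (h0 : (e.edge 0 n.zero_le).1.1.1 = Finsupp.single (w 0) 1)
    (hs : ∀ i h, (e.edge i h).1.2.1 = (e.edge i h).1.1.1 + Finsupp.single (w (i + 1)) 1) :
    ∀ i h, e.edge i h = (pathOfLetters w).1 i := by
  have key : ∀ i h, (e.edge i h).1.1.1 = letterCount (i + 1) w := by
    intro i
    induction i with
    | zero => intro h; rw [h0]; simp [letterCount]
    | succ i ih =>
      intro h
      have h1 : (e.edge (i + 1) h).1.1 = (e.edge i (Nat.le_of_succ_le h)).1.2 := e.comp i h
      rw [h1, hs, ih, letterCount_succ (i + 1)]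
  intro i h
  refine Subtype.ext (Prod.ext (Subtype.ext (key i h)) (Subtype.ext ?_))
  rw [hs, key, ← letterCount_succ]
  rfl

theorem pathOfLetters_lettersOfPath (x : pascalDiagram.PathSpace) :
    pathOfLetters (lettersOfPath x) = x := by
  refine Subtype.ext (funext fun n => ?_)
  exact (finPath_edge_eq (pathPrefix x n) (lettersOfPath x)
    (PascalVertex.exists_eq_single (x.1 0).1.1).choose_spec
    (fun i _ => (x.1 i).2.choose_spec) n le_rfl).symm

theorem pathOfLetters_edge_eq_iff {ω ω' : ℕ → ℕ} {i : ℕ} :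
    (pathOfLetters ω).1 i = (pathOfLetters ω').1 i ↔
      letterCount (i + 1) ω = letterCount (i + 1) ω' ∧ ω (i + 1) = ω' (i + 1) := by
  constructor
  · intro h
    have h1 : letterCount (i + 1) ω = letterCount (i + 1) ω' := congrArg (fun e => e.1.1.1) h
    have h2 : letterCount (i + 1 + 1) ω = letterCount (i + 1 + 1) ω' :=
      congrArg (fun e => e.1.2.1) h
    rw [letterCount_succ _ ω, letterCount_succ _ ω', h1] at h2
    exact ⟨h1, Finsupp.single_left_injective one_ne_zero (add_left_cancel h2)⟩
  · rintro ⟨h1, h2⟩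
    refine Subtype.ext (Prod.ext (Subtype.ext h1) (Subtype.ext ?_))
    change letterCount (i + 1 + 1) ω = letterCount (i + 1 + 1) ω'
    rw [letterCount_succ _ ω, letterCount_succ _ ω', h1, h2]

theorem pathOfLetters_edges_eq_iff {ω ω' : ℕ → ℕ} {n : ℕ} :
    (∀ i ≤ n, (pathOfLetters ω).1 i = (pathOfLetters ω').1 i) ↔ ∀ j < n + 2, ω j = ω' j := by
  constructor
  · rintro h (_ | j) hj
    · have h1 := (pathOfLetters_edge_eq_iff.mp (h 0 n.zero_le)).1
      simp only [letterCount, zero_add, Finset.sum_range_one] at h1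
      exact Finsupp.single_left_injective one_ne_zero h1
    · exact (pathOfLetters_edge_eq_iff.mp (h j (by omega))).2
  · intro h i hi
    exact pathOfLetters_edge_eq_iff.mpr
      ⟨letterCount_congr fun j hj => h j (by omega), h _ (by omega)⟩

theorem pathOfLetters_injective : Function.Injective pathOfLetters := by
  intro ω ω' h
  ext j
  exact (pathOfLetters_edges_eq_iff (n := j)).mp (fun i _ => by rw [h]) j (by omega)

theorem exists_finPath_edge_eq {n : ℕ} (e : pascalDiagram.FinPath n) :
    ∃ w, ∀ i h, e.edge i h = (pathOfLetters w).1 i := by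
  obtain ⟨a, ha⟩ := PascalVertex.exists_eq_single (e.edge 0 n.zero_le).1.1
  choose ℓ hℓ using fun (i : ℕ) (h : i ≤ n) => (e.edge i h).2
  refine ⟨consLetter a fun i => if h : i ≤ n then ℓ i h else 0, finPath_edge_eq e _ ha ?_⟩
  intro i h
  rw [hℓ i h]
  simp [consLetter, h]

theorem preimage_cylinder_pathPrefix (n : ℕ) (w : ℕ → ℕ) :
    pathOfLetters ⁻¹' (pathPrefix (pathOfLetters w) n).cylinder = prefixCylinder (n + 2) w :=
  Set.ext fun _ => pathOfLetters_edges_eq_iff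

/-- Every finite path is a beginning of the path of some sequence of letters. A path of the
diagram with `n + 1` edges starting in the first level is a word of `n + 2` letters. -/
theorem exists_eq_pathPrefix {n : ℕ} (e : pascalDiagram.FinPath n) :
    ∃ w, e = pathPrefix (pathOfLetters w) n := by
  obtain ⟨w, hw⟩ := exists_finPath_edge_eq e
  refine ⟨w, ?_⟩
  cases e
  simp only [pathPrefix, FinPath.mk.injEq]
  funext i h
  exact hw i h

theorem range_pathPrefix (n : ℕ) (w : ℕ → ℕ) :
    (pathPrefix (pathOfLetters w) n).range.1 = letterCount (n + 2) w := rfl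

instance : BorelSpace pascalDiagram.PathSpace := ⟨rfl⟩

theorem measurableSet_cylinder {n : ℕ} (e : pascalDiagram.FinPath n) :
    MeasurableSet e.cylinder := by
  have : IsOpen e.cylinder := TopologicalSpace.isOpen_generateFrom_of_mem ⟨n, e, rfl⟩
  exact this.measurableSet

theorem isOpen_prefixCylinder (n : ℕ) (w : ℕ → ℕ) : IsOpen (prefixCylinder n w) := by
  have : prefixCylinder n w = ⋂ j ∈ Finset.range n, (fun ω : ℕ → ℕ => ω j) ⁻¹' {w j} := by
    ext ω; simp [prefixCylinder]
  rw [this]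
  exact isOpen_biInter_finset fun j _ => (isOpen_discrete _).preimage (continuous_apply j)

theorem measurable_pathOfLetters : Measurable pathOfLetters := by
  refine Continuous.measurable (continuous_generateFrom_iff.mpr ?_)
  rintro _ ⟨n, e, rfl⟩
  obtain ⟨w, rfl⟩ := exists_eq_pathPrefix e
  rw [preimage_cylinder_pathPrefix]
  exact isOpen_prefixCylinder _ _

theorem measurable_lettersOfPath : Measurable lettersOfPath := by
  rw [generateFrom_prefixCylinder 2]
  refine measurable_generateFrom ?_
  rintro _ ⟨n, w, hn, rfl⟩
  obtain ⟨n, rfl⟩ := Nat.exists_eq_add_of_le' hn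
  rw [← preimage_cylinder_pathPrefix, ← Set.preimage_comp]
  have : pathOfLetters ∘ lettersOfPath = id := funext pathOfLetters_lettersOfPath
  rw [this]
  exact measurableSet_cylinder _

/-- The identification of sequences of letters with paths of the Pascal diagram. -/
noncomputable def pathEquiv : (ℕ → ℕ) ≃ᵐ pascalDiagram.PathSpace where
  toFun := pathOfLetters
  invFun := lettersOfPath
  left_inv _ := pathOfLetters_injective (pathOfLetters_lettersOfPath _)
  right_inv := pathOfLetters_lettersOfPath
  measurable_toFun := measurable_pathOfLetters
  measurable_invFun := measurable_lettersOfPath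

theorem map_pathEquiv_cylinder (μ : Measure (ℕ → ℕ)) (n : ℕ) (w : ℕ → ℕ) :
    μ.map pathEquiv (pathPrefix (pathOfLetters w) n).cylinder = μ (prefixCylinder (n + 2) w) := by
  rw [MeasurableEquiv.map_apply, ← preimage_cylinder_pathPrefix]
  rfl

theorem tailEquiv_comp_finitaryPerm {g : Equiv.Perm ℕ} (hg : g ∈ finitaryPerm) (ω : ℕ → ℕ) :
    TailEquiv (pathEquiv ω) (pathEquiv (ω ∘ g)) := by
  obtain ⟨N, hN⟩ := hg
  refine ⟨N, fun i hi => pathOfLetters_edge_eq_iff.mpr ⟨?_, ?_⟩⟩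
  · exact (letterCount_comp (fun j hj => hN j (by omega)) ω).symm
  · rw [Function.comp_apply, hN _ (by omega)]

theorem exists_finitaryPerm_of_tailEquiv {ω ω' : ℕ → ℕ}
    (h : TailEquiv (pathEquiv ω) (pathEquiv ω')) : ∃ g ∈ finitaryPerm, ω' = ω ∘ g := by
  obtain ⟨n, hn⟩ := h
  refine exists_finitaryPerm_of_letterCount_eq (n := n + 1)
    (pathOfLetters_edge_eq_iff.mp (hn n le_rfl)).1 fun j hj => ?_
  obtain ⟨j, rfl⟩ := Nat.exists_eq_add_of_le' hj
  exact (pathOfLetters_edge_eq_iff.mp (hn (j + n) (by omega))).2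

theorem tailErgodic_map_pathEquiv_iff {μ : Measure (ℕ → ℕ)} :
    TailErgodic (μ.map pathEquiv) ↔ PermErgodic μ := by
  constructor
  · intro h A hA hinv
    have := h (pathEquiv.symm ⁻¹' A) (pathEquiv.symm.measurable hA) fun x y hxy hx => by
      obtain ⟨ω, rfl⟩ := pathEquiv.surjective x
      obtain ⟨ω', rfl⟩ := pathEquiv.surjective y
      obtain ⟨g, hg, rfl⟩ := exists_finitaryPerm_of_tailEquiv hxy
      simp only [Set.mem_preimage, MeasurableEquiv.symm_apply_apply] at hx ⊢
      exact hinv g hg ω hx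
    rwa [← Set.preimage_compl, MeasurableEquiv.map_apply, MeasurableEquiv.map_apply,
      ← Set.preimage_comp, ← Set.preimage_comp, MeasurableEquiv.symm_comp_self] at this
  · intro h A hA hinv
    rw [MeasurableEquiv.map_apply, MeasurableEquiv.map_apply]
    exact h _ (pathEquiv.measurable hA) fun g hg ω hω =>
      hinv _ _ (tailEquiv_comp_finitaryPerm hg ω) hω

/-- Tail invariance says nothing about words of fewer than two letters, because a finite path has
at least one edge. -/
theorem tailInvariant_map_pathEquiv_iff {μ : Measure (ℕ → ℕ)} :
    TailInvariant (μ.map pathEquiv) ↔ ∀ n w v, 2 ≤ n → letterCount n w = letterCount n v →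
      μ (prefixCylinder n w) = μ (prefixCylinder n v) := by
  constructor
  · intro h n w v hn hwv
    obtain ⟨n, rfl⟩ := Nat.exists_eq_add_of_le' hn
    rw [← map_pathEquiv_cylinder, ← map_pathEquiv_cylinder]
    exact h n _ _ (Subtype.ext hwv)
  · intro h n e e' hee
    obtain ⟨w, rfl⟩ := exists_eq_pathPrefix e
    obtain ⟨v, rfl⟩ := exists_eq_pathPrefix e'
    rw [map_pathEquiv_cylinder, map_pathEquiv_cylinder]
    exact h _ _ _ (by omega) (congrArg Subtype.val hee)

/-! ### The measures on paths -/

/-- The measure on paths that corresponds to independent letters with distribution `d`. -/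
noncomputable def pascalMeasure (d : ProbVector) : Measure pascalDiagram.PathSpace :=
  (productLaw d).map pathEquiv

theorem pascalMeasure_frequency (d : ProbVector) : ∀ᵐ x ∂pascalMeasure d, ∀ i : ℕ,
    Tendsto (fun n : ℕ => ((x.vertex n).1 i : ℝ) / ((n : ℝ) + 1)) atTop (𝓝 (d.1 i)) := by
  rw [pascalMeasure, pathEquiv.measurableEmbedding.ae_map_iff, ae_all_iff]
  intro i
  filter_upwards [productLaw_tendsto_frequency d i 0] with ω hω
  refine (hω.comp (tendsto_add_atTop_nat 1)).congr fun n => ?_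
  have h1 : ((pathEquiv ω).vertex n).1 = letterCount (n + 1) ω := rfl
  rw [h1, letterCount_apply]
  simp

theorem mainTheorem1 :
    ∃ μ : ProbVector → Measure pascalDiagram.PathSpace,
      -- each `μ d` is a tail invariant probability measure with the prescribed cylinder values
      (∀ d, IsProbabilityMeasure (μ d) ∧ GenBratteliDiagram.TailInvariant (μ d) ∧
        (∀ (n : ℕ) (e : pascalDiagram.FinPath n),
          μ d e.cylinder = ENNReal.ofReal (pascalWeight d e.range.1)) ∧
        (∀ v : pascalDiagram.V 0,
          μ d {x | x.vertex 0 = v} = ENNReal.ofReal (pascalWeight d v.1))) ∧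
      -- and is the only measure with these cylinder values
      (∀ (d : ProbVector) (ν : Measure pascalDiagram.PathSpace),
        (∀ (n : ℕ) (e : pascalDiagram.FinPath n),
          ν e.cylinder = ENNReal.ofReal (pascalWeight d e.range.1)) → ν = μ d) ∧
      -- the measures `μ d` are exactly the ergodic tail invariant probability measures
      {ν : Measure pascalDiagram.PathSpace | IsProbabilityMeasure ν ∧
        GenBratteliDiagram.TailInvariant ν ∧ GenBratteliDiagram.TailErgodic ν} = Set.range μ ∧
      -- almost every path has coordinate frequencies `d`
      (∀ d, ∀ᵐ x ∂(μ d), ∀ i : ℕ,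
        Tendsto (fun n : ℕ => ((x.vertex n).1 i : ℝ) / ((n : ℝ) + 1)) atTop (𝓝 (d.1 i))) ∧
      -- distinct vectors give mutually singular measures
      (∀ d c : ProbVector, d ≠ c → (μ d).MutuallySingular (μ c)) := by
  have hprob : ∀ d, IsProbabilityMeasure (pascalMeasure d) := fun d =>
    Measure.isProbabilityMeasure_map pathEquiv.measurable.aemeasurable
  have hinv : ∀ d, TailInvariant (pascalMeasure d) := fun d =>
    tailInvariant_map_pathEquiv_iff.mpr fun n w v _ h => by
      rw [productLaw_prefixCylinder, productLaw_prefixCylinder, h]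
  have hpull : ∀ ν : Measure pascalDiagram.PathSpace, (ν.map pathEquiv.symm).map pathEquiv = ν :=
    fun ν => by simp
  refine ⟨pascalMeasure, fun d => ⟨hprob d, hinv d, fun n e => ?_, fun v => ?_⟩, ?_, ?_,
    pascalMeasure_frequency, ?_⟩
  · obtain ⟨w, rfl⟩ := exists_eq_pathPrefix e
    rw [pascalMeasure, map_pathEquiv_cylinder, productLaw_prefixCylinder, range_pathPrefix]
  · obtain ⟨i, hi⟩ := PascalVertex.exists_eq_single v
    have hcount : ∀ ω, letterCount 1 ω = Finsupp.single (ω 0) 1 := fun ω => by simp [letterCount]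
    have hpre : pathEquiv ⁻¹' {x | x.vertex 0 = v} = prefixCylinder 1 fun _ => i := by
      ext ω
      have h1 : (pathEquiv ω).vertex 0 = v ↔ letterCount 1 ω = v.1 := Subtype.ext_iff
      change (pathEquiv ω).vertex 0 = v ↔ ∀ j < 1, ω j = i
      rw [h1, hcount, hi, (Finsupp.single_left_injective one_ne_zero).eq_iff]
      simp
    rw [pascalMeasure, MeasurableEquiv.map_apply, hpre, productLaw_prefixCylinder, hcount, hi]
  · intro d ν hν
    rw [← hpull ν, pascalMeasure]
    congr 1
    refine (ext_of_prefixCylinder 2 fun n w hn => ?_).symm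
    obtain ⟨n, rfl⟩ := Nat.exists_eq_add_of_le' hn
    rw [productLaw_prefixCylinder, ← map_pathEquiv_cylinder, hpull, hν, range_pathPrefix]
  · refine Set.Subset.antisymm ?_ ?_
    · rintro ν ⟨h1, h2, h3⟩
      rw [← hpull ν] at h2 h3
      have : IsProbabilityMeasure (ν.map pathEquiv.symm) :=
        Measure.isProbabilityMeasure_map pathEquiv.symm.measurable.aemeasurable
      obtain ⟨d, hd⟩ := (tailErgodic_map_pathEquiv_iff.mp h3).exists_eq_productLaw 2
        (tailInvariant_map_pathEquiv_iff.mp h2)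
      exact ⟨d, by rw [pascalMeasure, hd, hpull]⟩
    · rintro _ ⟨d, rfl⟩
      exact ⟨hprob d, hinv d, tailErgodic_map_pathEquiv_iff.mpr (permErgodic_productLaw d)⟩
  · intro d c hdc
    refine Measure.MutuallySingular.mk (ae_iff.mp (pascalMeasure_frequency d))
      (ae_iff.mp (pascalMeasure_frequency c)) fun x _ => ?_
    by_contra h
    simp only [Set.mem_union, Set.mem_ofPred_eq, not_or, not_not] at h
    exact hdc (Subtype.ext (funext fun i => tendsto_nhds_unique (h.1 i) (h.2 i)))
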